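/- Let $n$ be a positive integer. A halved alternating sign matrix of order $2n$ is an $n\times 2n$ matrix $A=(a_{ij})$ with entries in $\{0,1,-1\}$ such that the non-zero entries alternate in sign in each row and in each column, every row sum equals $1$, and the first non-zero entry of each column (if there is any) is $1$. Its height matrix is the $(n+1)\times(2n+1)$ matrix $h_{ij}=i+j-2\sum_{l=1}^{i}\sum_{r=1}^{j}a_{lr}$, $0\le i\le n$, $0\le j\le 2n$. For integers $c_1,\dots,c_n$, let $\mathcal H_n(c_1,\dots,c_n)$ be the set of halved alternating sign matrices of order $2n$ whose height matrix has first row $0,1,\dots,2n$, first column $0,1,\dots,n$, last column $2n,2n-1,\dots,n$ (from top to bottom) and last row $n,c_1,n,c_2,n,\dots,n,c_n,n$. Let $N_-(A,\mathrm{even})$ be the number of entries $a_{ij}=-1$ with $i+j$ even, and $N_+(A,\mathrm{odd})$ the number of entries $a_{ij}=1$ with $i+j$ odd (rows and columns numbered from $1$), and put $$Z_n(c_1,\dots,c_n)=\sum_{A\in\mathcal H_n(c_1,\dots,c_n)}2^{N_-(A,\mathrm{even})+N_+(A,\mathrm{odd})}.$$ Then: (1) if $c_i=n+1$ for all $i$,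 then $Z_n(c_1,\dots,c_n)=5^{\binom n2}$ for even $n$ and $Z_n(c_1,\dots,c_n)=2^n5^{\binom n2}$ for odd $n$; (2) if $c_i=n-1$ for all $i$, then $Z_n(c_1,\dots,c_n)=2^n5^{\binom n2}$ for even $n$ and $Z_n(c_1,\dots,c_n)=5^{\binom n2}$ for odd $n$. -/

import Mathlib

/-- A halved alternating sign matrix of order `2n`: an `n × 2n` array with entries `0, 1, -1`
such that the nonzero entries alternate in sign along each row and each column, every row sum
is `1`, and the first nonzero entry of each column (if there is one) is `1`. -/
structure IsHalvedASM {n : ℕ} (A : Matrix (Fin n) (Fin (2 * n)) SignType) : Prop where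
  row_alternating : ∀ i : Fin n, ∀ j k : Fin (2 * n), j < k → A i j ≠ 0 → A i k ≠ 0 →
    (∀ l, j < l → l < k → A i l = 0) → A i k = -A i j
  col_alternating : ∀ j : Fin (2 * n), ∀ i k : Fin n, i < k → A i j ≠ 0 → A k j ≠ 0 →
    (∀ l, i < l → l < k → A l j = 0) → A k j = -A i j
  row_sum : ∀ i : Fin n, ∑ j, (A i j : ℤ) = 1
  col_first : ∀ j : Fin (2 * n), ∀ i : Fin n, A i j ≠ 0 → (∀ l, l < i → A l j = 0) → A i j = 1

/-- The height matrix, `h_{ij} = i + j - 2 ∑_{l ≤ i} ∑_{r ≤ j} a_{lr}` for `0 ≤ i ≤ n` and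
`0 ≤ j ≤ 2n`. The entries `a_{lr}` of the formula are indexed from `1`, those of `A` from `0`. -/
def heightMatrix {n : ℕ} (A : Matrix (Fin n) (Fin (2 * n)) SignType) :
    Matrix (Fin (n + 1)) (Fin (2 * n + 1)) ℤ :=
  fun i j => (i : ℤ) + (j : ℤ) -
    2 * ∑ l : Fin n with l.val + 1 ≤ i.val, ∑ r : Fin (2 * n) with r.val + 1 ≤ j.val, (A l r : ℤ)

/-- The boundary condition on an `(n+1) × (2n+1)` height matrix: top row `0, 1, …, 2n`,
left column `0, 1, …, n`, right column `2n, 2n-1, …, n`, and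
bottom row `n, c₁, n, c₂, n, …, n, c_n, n`. -/
structure HasBoundary {n : ℕ} (h : Matrix (Fin (n + 1)) (Fin (2 * n + 1)) ℤ)
    (c : Fin n → ℤ) : Prop where
  top : ∀ j : Fin (2 * n + 1), h 0 j = j
  left : ∀ i : Fin (n + 1), h i 0 = i
  right : ∀ i : Fin (n + 1), h i (Fin.last (2 * n)) = 2 * n - i
  bottom_even : ∀ k : Fin (n + 1), h (Fin.last n) ⟨2 * k, by omega⟩ = n
  bottom_odd : ∀ k : Fin n, h (Fin.last n) ⟨2 * k + 1, by omega⟩ = c k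

/-- `N₋(A, even)`: the number of entries `-1` in positions whose row and column indices
(counted from `1`) have an even sum. -/
def numNegEven {n : ℕ} (A : Matrix (Fin n) (Fin (2 * n)) SignType) : ℕ :=
  Finset.card {p : Fin n × Fin (2 * n) |
    A p.1 p.2 = -1 ∧ Even ((p.1.val + 1) + (p.2.val + 1))}

/-- `N₊(A, odd)`: the number of entries `1` in positions whose row and column indices
(counted from `1`) have an odd sum. -/
def numPosOdd {n : ℕ} (A : Matrix (Fin n) (Fin (2 * n)) SignType) : ℕ :=
  Finset.card {p : Fin n × Fin (2 * n) |
    A p.1 p.2 = 1 ∧ Odd ((p.1.val + 1) + (p.2.val + 1))}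

open Classical in
/-- The weighted enumeration, with weight `2 ^ (N₋(A, even) + N₊(A, odd))`, of the halved
alternating sign matrices of order `2n` whose height matrix satisfies the boundary condition
with bottom row entries `c₁, …, c_n`. -/
noncomputable def fortressCount (n : ℕ) (c : Fin n → ℤ) : ℕ :=
  ∑ A : Matrix (Fin n) (Fin (2 * n)) SignType with
    IsHalvedASM A ∧ HasBoundary (heightMatrix A) c, 2 ^ (numNegEven A + numPosOdd A)

/-! Build the matrix row by row, recording after `m` rows the set of columns of sum `1`. These sets
have `m` elements, and the sets of consecutive rows interlace; the bottom boundary prescribes the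
last set as the columns `2k + e`. The weight of a row leading from `Y` to `X` is a product of parity
weights over `X` and over `Y`, times `1/2` for each common element (`signWeight_transitionRow`). In
an interlacing pair the common elements are those of `Y` that lie at an end point of their interval,
so the sum over `Y` is a product of trapezoidal sums. Such a sum sends a determinant of one-variable
functions to another one (`sum_interlacing_mul_det`). By induction on the rows, the count is a
product of parity weights times a determinant of wave functions (`partialASMCount_image`). On
columns with step `2` this determinant is evaluated by differences of step `2`. Differencing a
trapezoidal sum averages its integrand with mass `w x + w (x + 1) = 4 + 1 = 5`, where `w` is the
squared parity weight. Hence the `j`-th wave function has constant `j`-th difference `5 ^ j`, and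
the determinant is `∏ 5 ^ j = 5 ^ n.choose 2`. The parity weights of the last set contribute `2 ^ n`
or `1`. -/

/-! ### Alternating sign sequences and partial sums -/

theorem sum_filter_val_succ {N : ℕ} (f : Fin N → ℤ) (k : Fin N) :
    ∑ l : Fin N with l.val < k.val + 1, f l = ∑ l : Fin N with l.val < k.val, f l + f k := by
  have : (Finset.univ.filter fun l : Fin N => l.val < k + 1) =
      insert k (Finset.univ.filter fun l : Fin N => l.val < k) := by
    ext l
    simp only [Finset.mem_filter, Finset.mem_univ, true_and, Finset.mem_insert, Fin.ext_iff]
    omega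
  rw [this, Finset.sum_insert (by simp), add_comm]

/-- The partial sums of a sequence of signs. -/
def signPartialSum {N : ℕ} (a : Fin N → SignType) (k : ℕ) : ℤ :=
  ∑ l : Fin N with l.val < k, (a l : ℤ)

theorem signPartialSum_zero {N : ℕ} (a : Fin N → SignType) : signPartialSum a 0 = 0 := by
  simp [signPartialSum]

theorem signPartialSum_of_le {N : ℕ} (a : Fin N → SignType) {k : ℕ} (hk : N ≤ k) :
    signPartialSum a k = ∑ l, (a l : ℤ) := by
  unfold signPartialSum
  rw [Finset.filter_true_of_mem]
  intro l _
  omega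

theorem signPartialSum_succ {N : ℕ} (a : Fin N → SignType) (k : Fin N) :
    signPartialSum a (k + 1) = signPartialSum a k + a k :=
  sum_filter_val_succ _ k

/-- All the partial sums are `0` or `1`. -/
def HasUnitPartialSums {N : ℕ} (a : Fin N → SignType) : Prop :=
  ∀ k, signPartialSum a k = 0 ∨ signPartialSum a k = 1

theorem signPartialSum_eq_of_zero {N : ℕ} (a : Fin N → SignType) {j k : ℕ} (hjk : j ≤ k)
    (h : ∀ l : Fin N, j ≤ l.val → l.val < k → a l = 0) :
    signPartialSum a k = signPartialSum a j := by
  unfold signPartialSum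
  symm
  apply Finset.sum_subset
  · intro l
    simp only [Finset.mem_filter, Finset.mem_univ, true_and]
    omega
  · intro l
    simp only [Finset.mem_filter, Finset.mem_univ, true_and, not_lt]
    intro h1 h2
    simp [h l h2 h1]

theorem hasUnitPartialSums_iff {N : ℕ} (a : Fin N → SignType) :
    HasUnitPartialSums a ↔
      (∀ j k : Fin N, j < k → a j ≠ 0 → a k ≠ 0 → (∀ l, j < l → l < k → a l = 0) →
        a k = -a j) ∧
      (∀ i, a i ≠ 0 → (∀ l, l < i → a l = 0) → a i = 1) := by
  constructor
  · intro h
    constructor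
    · intro j k hjk hj hk hz
      have e : signPartialSum a k = signPartialSum a (j + 1) := by
        apply signPartialSum_eq_of_zero a (by omega)
        intro l h1 h2
        exact hz l (by omega) (by omega)
      have e1 := signPartialSum_succ a j
      have e2 := signPartialSum_succ a k
      have a1 := h j
      have a2 := h (j + 1)
      have a3 := h (k + 1)
      generalize a j = s at *
      generalize a k = t at *
      cases s <;> cases t <;> simp_all <;> omega
    · intro i hi hz
      have e : signPartialSum a i = signPartialSum a 0 := by
        apply signPartialSum_eq_of_zero a (by omega)
        intro l _ h2
        exact hz l (by omega)
      have e1 := signPartialSum_succ a i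
      have e0 := signPartialSum_zero a
      have a3 := h (i + 1)
      generalize a i = s at *
      cases s <;> simp_all
  · rintro ⟨halt, hfirst⟩
    -- The induction needs the last nonzero sign so far: none, `-1` or `1`. It determines the
    -- partial sum and, by alternation, the next nonzero sign.
    have key : ∀ k, k ≤ N →
        (signPartialSum a k = 0 ∧ ∀ l : Fin N, l.val < k → a l = 0) ∨
        (signPartialSum a k = 0 ∧ ∃ l : Fin N, l.val < k ∧ a l = -1 ∧
          ∀ l' : Fin N, l < l' → l'.val < k → a l' = 0) ∨
        (signPartialSum a k = 1 ∧ ∃ l : Fin N, l.val < k ∧ a l = 1 ∧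
          ∀ l' : Fin N, l < l' → l'.val < k → a l' = 0) := by
      intro k
      induction k with
      | zero => intro _; left; simp [signPartialSum_zero]
      | succ k ih =>
        intro hk
        have hs := signPartialSum_succ a ⟨k, hk⟩
        simp only at hs
        have hlt : ∀ l : Fin N, l.val < k + 1 → l.val < k ∨ l = ⟨k, hk⟩ := by
          intro l hl
          rw [Fin.ext_iff]
          simp only
          omega
        by_cases h0 : a ⟨k, hk⟩ = 0
        · simp only [h0, SignType.coe_zero, add_zero] at hs
          rw [hs]
          rcases ih (by omega) with ⟨h1, h2⟩ | ⟨h1, l, hl, h2, h3⟩ | ⟨h1, l, hl, h2, h3⟩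
          · left
            refine ⟨h1, fun l hl => ?_⟩
            rcases hlt l hl with h | rfl
            exacts [h2 l h, h0]
          · right; left
            refine ⟨h1, l, by omega, h2, fun l' hl hl' => ?_⟩
            rcases hlt l' hl' with h | rfl
            exacts [h3 l' hl h, h0]
          · right; right
            refine ⟨h1, l, by omega, h2, fun l' hl hl' => ?_⟩
            rcases hlt l' hl' with h | rfl
            exacts [h3 l' hl h, h0]
        · have hvac : ∀ l' : Fin N, (⟨k, hk⟩ : Fin N) < l' → l'.val < k + 1 → a l' = 0 := by
            intro l' h1 h2
            rw [Fin.lt_def] at h1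
            simp only at h1
            omega
          rcases ih (by omega) with ⟨h1, h2⟩ | ⟨h1, l, hl, h2, h3⟩ | ⟨h1, l, hl, h2, h3⟩
          · have e := hfirst ⟨k, hk⟩ h0 (fun l hl => h2 l hl)
            right; right
            exact ⟨by simp [hs, h1, e], ⟨k, hk⟩, by simp, e, hvac⟩
          · have e := halt l ⟨k, hk⟩ hl (by simp [h2]) h0 (fun l' h4 h5 => h3 l' h4 h5)
            rw [h2, neg_neg] at e
            right; right
            exact ⟨by simp [hs, h1, e], ⟨k, hk⟩, by simp, e, hvac⟩
          · have e := halt l ⟨k, hk⟩ hl (by simp [h2]) h0 (fun l' h4 h5 => h3 l' h4 h5)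
            rw [h2] at e
            right; left
            exact ⟨by simp [hs, h1, e], ⟨k, hk⟩, by simp, e, hvac⟩
    intro k
    rcases le_total k N with hk | hk
    · rcases key k hk with h | h | h
      exacts [Or.inl h.1, Or.inl h.1, Or.inr h.1]
    · rw [signPartialSum_of_le a hk, ← signPartialSum_of_le a le_rfl]
      rcases key N le_rfl with h | h | h
      exacts [Or.inl h.1, Or.inl h.1, Or.inr h.1]

/-- If an alternating sequence began with `-1`, its negative would have partial sums `0` or `1`,
against its total `-1`. -/
theorem hasUnitPartialSums_iff_of_sum_eq_one {N : ℕ} (a : Fin N → SignType)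
    (hsum : ∑ j, (a j : ℤ) = 1) :
    HasUnitPartialSums a ↔
      ∀ j k : Fin N, j < k → a j ≠ 0 → a k ≠ 0 → (∀ l, j < l → l < k → a l = 0) →
        a k = -a j := by
  refine ⟨fun h => ((hasUnitPartialSums_iff a).1 h).1, fun halt => ?_⟩
  refine (hasUnitPartialSums_iff a).2 ⟨halt, fun i hi hz => ?_⟩
  by_contra hne
  have hi' : a i = -1 := by
    generalize a i = s at *
    cases s <;> simp_all
  have h : HasUnitPartialSums (fun j => -a j) := by
    rw [hasUnitPartialSums_iff]
    constructor
    · intro j k hjk hj hk hl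
      rw [halt j k hjk (by simpa using hj) (by simpa using hk)
        (fun l h1 h2 => by simpa using hl l h1 h2)]
    · intro k hk hl
      have : k = i := by
        rcases lt_trichotomy k i with h | h | h
        · exact absurd (hz k h) (by simpa using hk)
        · exact h
        · exact absurd (by simpa using hl i h) hi
      rw [this, hi', neg_neg]
  have h1 := h N
  have h2 : signPartialSum (fun j => -a j) N = -1 := by
    rw [signPartialSum_of_le _ le_rfl, ← hsum, ← Finset.sum_neg_distrib]
    refine Finset.sum_congr rfl fun j _ => ?_
    generalize a j = s
    cases s <;> rfl
  omega

/-! ### Determinants from finite differences -/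

/-- Newton's forward difference formula factors the matrix into the unitriangular matrix of binomial
coefficients and the matrix of iterated differences at `x₀`. The latter is upper triangular with
diagonal `c`, since differences beyond the constant one vanish. -/
theorem Matrix.det_of_iterate_fwdDiff_eq_const {R : Type*} [CommRing R] {n : ℕ}
    (f : Fin n → ℕ → R) (c : Fin n → R) (h : ℕ)
    (hf : ∀ (j : Fin n) x, ((fwdDiff h)^[(j : ℕ)] (f j)) x = c j) (x₀ : ℕ) :
    (Matrix.of fun i j : Fin n => f j (x₀ + (i : ℕ) * h)).det = ∏ j, c j := by
  have hzero : ∀ (j : Fin n) (k : ℕ), (j : ℕ) < k → ((fwdDiff h)^[k] (f j)) x₀ = 0 := by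
    intro j k hk
    obtain ⟨d, rfl⟩ := Nat.exists_eq_add_of_lt hk
    have e : (fwdDiff h)^[(j : ℕ)] (f j) = fun _ => c j := funext (hf j)
    rw [show (j : ℕ) + d + 1 = (d + 1) + j by ring, Function.iterate_add_apply, e,
      Function.iterate_succ_apply]
    have e0 : ((fwdDiff h) (fun _ : ℕ => c j)) = fun _ => 0 := by
      ext; simp [fwdDiff]
    rw [e0]
    clear e0 e hk
    induction d with
    | zero => rfl
    | succ d ih =>
      rw [Function.iterate_succ_apply]
      have : ((fwdDiff h) (fun _ : ℕ => (0 : R))) = fun _ => 0 := by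
        ext; simp [fwdDiff]
      rw [this, ih]
  have hLU : (Matrix.of fun i j : Fin n => f j (x₀ + (i : ℕ) * h)) =
      (Matrix.of fun i k : Fin n => (((i : ℕ).choose k : ℕ) : R)) *
        (Matrix.of fun k j : Fin n => ((fwdDiff h)^[(k : ℕ)] (f j)) x₀) := by
    ext i j
    have e := shift_eq_sum_fwdDiff_iter h (f j) (i : ℕ) x₀
    rw [smul_eq_mul] at e
    simp only [Matrix.of_apply, Matrix.mul_apply]
    rw [e, Fin.sum_univ_eq_sum_range (fun k =>
      (((i : ℕ).choose k : ℕ) : R) * ((fwdDiff h)^[k] (f j)) x₀) n]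
    simp only [nsmul_eq_mul]
    apply Finset.sum_subset
    · intro k
      simp only [Finset.mem_range]
      omega
    · intro k _ hk
      rw [Finset.mem_range, not_lt] at hk
      rw [Nat.choose_eq_zero_of_lt hk, Nat.cast_zero, zero_mul]
  rw [hLU, Matrix.det_mul, Matrix.det_of_isLowerTriangular, Matrix.det_of_isUpperTriangular]
  · simp [hf]
  · intro k j hjk
    exact hzero j k hjk
  · intro i k hik
    simp only [Matrix.of_apply]
    rw [Nat.choose_eq_zero_of_lt (show (i : ℕ) < k from hik), Nat.cast_zero]

/-! ### Wave functions and their differences -/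

/-- The weight `2` at the sites `m + y` even, and `1` elsewhere. -/
def parityWeight (m y : ℕ) : ℚ := if Even (m + y) then 2 else 1

/-- The trapezoidal discrete antiderivative. -/
def trapezoidSum (g : ℕ → ℚ) (x : ℕ) : ℚ := ∑ y ∈ Finset.range x, g y + g x / 2

/-- The single-particle wave functions of the transfer operators. -/
def waveFunction : ℕ → ℕ → ℕ → ℚ
  | 0, _ => fun _ => 1
  | j + 1, m =>
    trapezoidSum fun y => parityWeight (m - 1) y ^ 2 * waveFunction j (m - 1) y

theorem trapezoidSum_sub {g : ℕ → ℚ} {a b : ℕ} (hab : a < b) :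
    trapezoidSum g b - trapezoidSum g a =
      ∑ y ∈ Finset.Icc a b, (if y = a ∨ y = b then 1 / 2 else 1) * g y := by
  have h1 : Finset.Icc a b = insert a (insert b (Finset.Ioo a b)) := by
    ext y
    simp only [Finset.mem_Icc, Finset.mem_insert, Finset.mem_Ioo]
    omega
  have h2 : Finset.range b = Finset.range a ∪ insert a (Finset.Ioo a b) := by
    ext y
    simp only [Finset.mem_range, Finset.mem_union, Finset.mem_insert, Finset.mem_Ioo]
    omega
  have h3 : Disjoint (Finset.range a) (insert a (Finset.Ioo a b)) := by
    rw [Finset.disjoint_left]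
    intro y
    simp only [Finset.mem_range, Finset.mem_insert, Finset.mem_Ioo]
    omega
  have h4 : ∑ y ∈ Finset.Ioo a b, (if y = a ∨ y = b then (1 / 2 : ℚ) else 1) * g y =
      ∑ y ∈ Finset.Ioo a b, g y := by
    refine Finset.sum_congr rfl fun y hy => ?_
    rw [Finset.mem_Ioo] at hy
    rw [if_neg (by omega), one_mul]
  unfold trapezoidSum
  rw [h1, h2, Finset.sum_union h3, Finset.sum_insert (by simp), Finset.sum_insert,
    Finset.sum_insert (by simp), h4]
  · simp only [true_or, or_true, if_true]
    ring
  · simp only [Finset.mem_insert, Finset.mem_Ioo]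
    omega

/-- The smoothing operator arising from a double step of the trapezoidal sum. -/
def smoothing (w f : ℕ → ℚ) (x : ℕ) : ℚ :=
  w x * f x / 2 + w (x + 1) * f (x + 1) + w (x + 2) * f (x + 2) / 2

theorem fwdDiff_trapezoidSum (w f : ℕ → ℚ) :
    (fwdDiff 2) (trapezoidSum fun y => w y * f y) = smoothing w f := by
  ext x
  simp only [fwdDiff, trapezoidSum, smoothing, Finset.sum_range_succ]
  ring

/-- A weight of period `2` is unaffected by the shift by `2`, so smoothing commutes with that shift.
-/
theorem iterate_fwdDiff_smoothing {w : ℕ → ℚ} (hw : ∀ x, w (x + 2) = w x) (f : ℕ → ℚ) (k : ℕ) :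
    (fwdDiff 2)^[k] (smoothing w f) = smoothing w ((fwdDiff 2)^[k] f) := by
  induction k with
  | zero => rfl
  | succ k ih =>
    rw [Function.iterate_succ_apply', ih, Function.iterate_succ_apply']
    ext x
    simp only [fwdDiff, smoothing]
    rw [show x + 2 + 1 = x + 1 + 2 by ring, hw x, hw (x + 1), hw (x + 2), hw x]
    ring

/-- Smoothing a constant multiplies it by `5`, whichever of the two neighbouring sites has weight
`4`. The truncation of `m - 1` at `m = 0` is harmless, as only the parity pattern matters. -/
theorem iterate_fwdDiff_waveFunction (j m x : ℕ) :
    ((fwdDiff 2)^[j] (waveFunction j m)) x = 5 ^ j := by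
  induction j generalizing m x with
  | zero => simp [waveFunction]
  | succ j ih =>
    have h2 : ∀ x, parityWeight (m - 1) (x + 2) ^ 2 = parityWeight (m - 1) x ^ 2 := by
      intro x
      simp only [parityWeight, ← add_assoc]
      simp [Nat.even_add]
    rw [Function.iterate_succ_apply, waveFunction, fwdDiff_trapezoidSum,
      iterate_fwdDiff_smoothing h2, smoothing, ih, ih, ih, h2]
    by_cases h : Even (m - 1 + x)
    · have h' : ¬ Even (m - 1 + (x + 1)) := by
        rw [← add_assoc, Nat.even_add_one]; simpa using h
      simp only [parityWeight, if_pos h, if_neg h']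
      ring
    · have h' : Even (m - 1 + (x + 1)) := by
        rw [← add_assoc, Nat.even_add_one]; simpa using h
      simp only [parityWeight, if_pos h', if_neg h]
      ring

theorem det_waveFunction (n m x₀ : ℕ) :
    (Matrix.of fun i j : Fin n => waveFunction j m (x₀ + (i : ℕ) * 2)).det =
      5 ^ n.choose 2 := by
  rw [Matrix.det_of_iterate_fwdDiff_eq_const (fun j : Fin n => waveFunction j m)
    (fun j => 5 ^ (j : ℕ)) 2 (fun j x => iterate_fwdDiff_waveFunction j m x),
    Fin.prod_univ_eq_prod_range (fun j => (5 : ℚ) ^ j) n, Finset.prod_pow_eq_pow_sum,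
    Finset.sum_range_id, Nat.choose_two_right]

/-! ### Summing a determinant over interlacing sequences -/

theorem strictMono_of_mem_Icc_of_injective {N m : ℕ} {x : Fin (m + 1) → Fin N}
    {y : Fin m → Fin N} (hy : ∀ i, y i ∈ Finset.Icc (x i.castSucc) (x i.succ))
    (hinj : Function.Injective y) : StrictMono y := by
  cases m with
  | zero => exact fun i => i.elim0
  | succ m =>
    rw [Fin.strictMono_iff_lt_succ]
    intro i
    have h1 := (Finset.mem_Icc.1 (hy i.castSucc)).2
    have h2 := (Finset.mem_Icc.1 (hy i.succ)).1
    rw [Fin.succ_castSucc] at h1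
    refine lt_of_le_of_ne (h1.trans h2) fun h => ?_
    exact absurd (hinj h) (Fin.castSucc_lt_succ (i := i)).ne

/-- The factor `1 / 2` at the end points of the interval `[a, b]`. -/
def endpointWeight (a b y : ℕ) : ℚ := if y = a ∨ y = b then 1 / 2 else 1

theorem Matrix.det_eq_sum_prod_row {R : Type*} [CommRing R] {m : ℕ} (M : Matrix (Fin m) (Fin m) R) :
    M.det = ∑ σ : Equiv.Perm (Fin m), ((Equiv.Perm.sign σ : ℤ) : R) * ∏ i, M i (σ i) := by
  rw [← Matrix.det_transpose, Matrix.det_apply']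
  rfl

open Classical in
theorem sum_interlacing_mul_det {N m : ℕ} {x : Fin (m + 1) → Fin N} (hx : StrictMono x)
    (w : ℕ → ℚ) (φ : Fin m → ℕ → ℚ) :
    ∑ y ∈ Fintype.piFinset (fun i : Fin m => Finset.Icc (x i.castSucc) (x i.succ)) with
        StrictMono y,
      (∏ i, endpointWeight (x i.castSucc) (x i.succ) (y i) * w (y i)) *
        (Matrix.of fun i j => φ j (y i)).det =
    (Matrix.of fun i j : Fin (m + 1) =>
      (Fin.cons 1 (fun j : Fin m => trapezoidSum (fun y => w y * φ j y) (x i)) :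
        Fin (m + 1) → ℚ) j).det := by
  set B : Matrix (Fin (m + 1)) (Fin (m + 1)) ℚ := Matrix.of fun i j =>
    (Fin.cons 1 (fun j : Fin m => trapezoidSum (fun y => w y * φ j y) (x i)) :
        Fin (m + 1) → ℚ) j with hB
  set D : Matrix (Fin m) (Fin m) ℚ := Matrix.of fun i j =>
    ∑ y ∈ Finset.Icc (x i.castSucc) (x i.succ),
      (endpointWeight (x i.castSucc) (x i.succ) y * w y) * φ j y with hD
  have hDB : ∀ i j, D i j = B i.succ j.succ - B i.castSucc j.succ := by
    intro i j
    have hlt : (x i.castSucc : ℕ) < x i.succ := hx (Fin.castSucc_lt_succ (i := i))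
    simp only [hB, hD, Matrix.of_apply, Fin.cons_succ]
    rw [trapezoidSum_sub hlt, ← Fin.map_valEmbedding_Icc, Finset.sum_map]
    refine Finset.sum_congr rfl fun y _ => ?_
    simp only [endpointWeight, Fin.valEmbedding_apply, mul_assoc]
  have hdetB : B.det = D.det := by
    let C : Matrix (Fin (m + 1)) (Fin (m + 1)) ℚ :=
      Matrix.of (Fin.cons (B 0) fun i j => B i.succ j - B i.castSucc j)
    -- Subtracting from each row its predecessor clears the column of ones below its top entry and
    -- leaves `D` as the complementary minor.
    rw [Matrix.det_eq_of_forall_row_eq_smul_add_pred (B := C) (fun _ => 1)]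
    · rw [Matrix.det_succ_column_zero, Fin.sum_univ_succ, Finset.sum_eq_zero]
      · have h00 : C 0 0 = 1 := by simp [C, B]
        rw [h00, Fin.val_zero, pow_zero, one_mul, one_mul, add_zero]
        congr 1
        ext i j
        rw [hDB]
        simp [C]
      · intro i _
        have : C i.succ 0 = 0 := by simp [C, B]
        rw [this, mul_zero, zero_mul]
    · intro j
      simp [C]
    · intro i j
      simp [C]
  -- Strictness of `y` can be dropped: an interlacing `y` that is not strict repeats a value, giving
  -- a determinant with two equal rows. The sum then runs over a product of intervals and factors.
  rw [hdetB, Finset.sum_filter_of_ne]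
  · simp only [Matrix.det_eq_sum_prod_row, hD, Matrix.of_apply, Finset.mul_sum]
    rw [Finset.sum_comm]
    refine Finset.sum_congr rfl fun σ _ => ?_
    rw [Finset.prod_univ_sum, Finset.mul_sum]
    refine Finset.sum_congr rfl fun y _ => ?_
    simp only [Finset.prod_mul_distrib]
    ring
  · intro y hy hne
    rw [Fintype.mem_piFinset] at hy
    refine strictMono_of_mem_Icc_of_injective hy fun i j hij => ?_
    by_contra hij'
    refine hne ?_
    rw [Matrix.det_zero_of_row_eq hij', mul_zero]
    ext k
    simp [hij]

/-! ### Interlacing in terms of counting functions -/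

theorem strictMono_lt_iff_lt_card {N m : ℕ} {x : Fin m → Fin N} (hx : StrictMono x) (i : Fin m)
    (k : ℕ) :
    (x i : ℕ) < k ↔ (i : ℕ) < (Finset.univ.filter fun i' => (x i' : ℕ) < k).card := by
  constructor
  · intro h
    have hs : Finset.Iic i ⊆ Finset.univ.filter fun i' => (x i' : ℕ) < k := by
      intro i' hi'
      rw [Finset.mem_Iic] at hi'
      have := hx.monotone hi'
      simp only [Finset.mem_filter, Finset.mem_univ, true_and]
      omega
    have := Finset.card_le_card hs
    rw [Fin.card_Iic] at this
    omega
  · intro h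
    by_contra hk
    have hs : (Finset.univ.filter fun i' => (x i' : ℕ) < k) ⊆ Finset.Iio i := by
      intro i' hi'
      simp only [Finset.mem_filter, Finset.mem_univ, true_and] at hi'
      rw [Finset.mem_Iio]
      by_contra hi
      have := hx.monotone (not_lt.1 hi)
      omega
    have := Finset.card_le_card hs
    rw [Fin.card_Iio] at this
    omega

theorem interlacing_iff {N m : ℕ} {x : Fin (m + 1) → Fin N} {y : Fin m → Fin N}
    (hx : StrictMono x) (hy : StrictMono y) :
    (∀ k : ℕ, (Finset.univ.filter fun i => (y i : ℕ) < k).card ≤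
        (Finset.univ.filter fun i => (x i : ℕ) < k).card ∧
      (Finset.univ.filter fun i => (x i : ℕ) < k).card ≤
        (Finset.univ.filter fun i => (y i : ℕ) < k).card + 1) ↔
      ∀ i, y i ∈ Finset.Icc (x i.castSucc) (x i.succ) := by
  constructor
  · intro h i
    rw [Finset.mem_Icc, Fin.le_def, Fin.le_def]
    constructor
    · by_contra hlt
      have h1 := (strictMono_lt_iff_lt_card hy i (x i.castSucc)).1 (by omega)
      have h2 := (strictMono_lt_iff_lt_card hx i.castSucc (x i.castSucc)).2
      have h3 := h (x i.castSucc)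
      simp only [Fin.val_castSucc] at h2
      omega
    · by_contra hlt
      have h1 := (strictMono_lt_iff_lt_card hx i.succ (y i)).1 (by omega)
      have h2 := (strictMono_lt_iff_lt_card hy i (y i)).2
      have h3 := h (y i)
      simp only [Fin.val_succ] at h1
      omega
  · intro h k
    have h' : ∀ i, x i.castSucc ≤ y i ∧ y i ≤ x i.succ := fun i => Finset.mem_Icc.1 (h i)
    simp only [Fin.le_def] at h'
    constructor
    · rw [← Finset.card_map Fin.castSuccEmb]
      apply Finset.card_le_card
      intro i hi
      simp only [Finset.mem_map, Finset.mem_filter, Finset.mem_univ, true_and] at hi ⊢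
      obtain ⟨i, hi, rfl⟩ := hi
      have := (h' i).1
      simp only [Fin.coe_castSuccEmb]
      omega
    · rw [← Finset.card_map (Fin.succEmb m)]
      -- The index `0`, which is no successor, accounts for the `+ 1`.
      refine (Finset.card_le_card ?_).trans (Finset.card_insert_le 0 _)
      intro i hi
      simp only [Finset.mem_insert, Finset.mem_map, Finset.mem_filter, Finset.mem_univ,
        true_and] at hi ⊢
      induction i using Fin.cases with
      | zero => exact Or.inl rfl
      | succ i =>
        refine Or.inr ⟨i, ?_, rfl⟩
        have := (h' i).2
        omega

/-! ### The transfer operator of a row -/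

/-- The row of signs leading from the set `Y` of columns of sum `1` to the set `X`. -/
def transitionRow {N : ℕ} (X Y : Finset (Fin N)) (j : Fin N) : SignType :=
  if j ∈ X then (if j ∈ Y then 0 else 1) else (if j ∈ Y then -1 else 0)

theorem eq_transitionRow_iff {N : ℕ} (X Y : Finset (Fin N)) (r : Fin N → SignType) :
    (∀ j, (if j ∈ Y then (1 : ℤ) else 0) + r j = if j ∈ X then 1 else 0) ↔
      r = transitionRow X Y := by
  rw [funext_iff]
  refine forall_congr' fun j => ?_
  unfold transitionRow
  generalize r j = s
  by_cases h1 : j ∈ X <;> by_cases h2 : j ∈ Y <;> cases s <;> simp [h1, h2]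

theorem signPartialSum_transitionRow {N : ℕ} (X Y : Finset (Fin N)) (k : ℕ) :
    signPartialSum (transitionRow X Y) k =
      ((X.filter fun j => j.val < k).card : ℤ) - (Y.filter fun j => j.val < k).card := by
  have h := (eq_transitionRow_iff X Y (transitionRow X Y)).2 rfl
  have h' : ∀ j, (transitionRow X Y j : ℤ) =
      (if j ∈ X then (1 : ℤ) else 0) - if j ∈ Y then 1 else 0 := fun j => by
    rw [← h j]; ring
  have hc : ∀ Z : Finset (Fin N), ∑ l : Fin N with l.val < k, (if l ∈ Z then (1 : ℤ) else 0) =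
      (Z.filter fun j => j.val < k).card := by
    intro Z
    rw [Finset.sum_ite, Finset.sum_const_zero, add_zero, Finset.sum_const, nsmul_one]
    congr 2
    ext j
    simp [and_comm]
  unfold signPartialSum
  simp only [h', Finset.sum_sub_distrib, hc]

/-- The weight of a sign at the site `(m, j)`. -/
def signWeight (m j : ℕ) (s : SignType) : ℚ :=
  if (s = -1 ∧ Even (m + j)) ∨ (s = 1 ∧ Odd (m + j)) then 2 else 1

/-- For a column in both sets the sign is `0`, of weight `1`, while exactly one of the parity
weights at `m` and `m + 1` is `2`; the factor `1 / 2` compensates. -/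
theorem signWeight_transitionRow {N : ℕ} (X Y : Finset (Fin N)) (m : ℕ) (j : Fin N) :
    signWeight m j (transitionRow X Y j) = (if j ∈ X then parityWeight (m + 1) j else 1) *
      (if j ∈ Y then (if j ∈ X then 1 / 2 else 1) * parityWeight m j else 1) := by
  have hp : Even (m + 1 + j) ↔ ¬ Even (m + j) := by
    rw [add_right_comm, Nat.even_add_one]
  unfold signWeight transitionRow parityWeight
  simp only [hp, ← Nat.not_even_iff_odd]
  by_cases h1 : j ∈ X <;> by_cases h2 : j ∈ Y <;> by_cases h3 : Even (m + (j : ℕ)) <;>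
    simp [h1, h2, h3]

open Classical in
/-- The matrix entries of the transfer operator of row `m`. -/
noncomputable def transferWeight {N : ℕ} (m : ℕ) (X Y : Finset (Fin N)) : ℚ :=
  if HasUnitPartialSums (transitionRow X Y) ∧ ∑ j, (transitionRow X Y j : ℤ) = 1 then
    ∏ j : Fin N, signWeight m j (transitionRow X Y j)
  else 0

theorem transitionRow_admissible_iff {N : ℕ} (X Y : Finset (Fin N)) :
    (HasUnitPartialSums (transitionRow X Y) ∧ ∑ j, (transitionRow X Y j : ℤ) = 1) ↔
      (∀ k : ℕ, (Y.filter fun j => j.val < k).card ≤ (X.filter fun j => j.val < k).card ∧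
        (X.filter fun j => j.val < k).card ≤ (Y.filter fun j => j.val < k).card + 1) ∧
      X.card = Y.card + 1 := by
  have h1 : ∑ j, (transitionRow X Y j : ℤ) = (X.card : ℤ) - Y.card := by
    rw [← signPartialSum_of_le _ le_rfl, signPartialSum_transitionRow,
      Finset.filter_true_of_mem fun j _ => j.2, Finset.filter_true_of_mem fun j _ => j.2]
  rw [h1]
  refine and_congr (forall_congr' fun k => ?_) (by omega)
  rw [signPartialSum_transitionRow]
  omega

theorem card_filter_image {N m : ℕ} {x : Fin m → Fin N} (hx : StrictMono x) (k : ℕ) :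
    ((Finset.univ.image x).filter fun j => j.val < k).card =
      (Finset.univ.filter fun i => (x i : ℕ) < k).card := by
  rw [Finset.filter_image, Finset.card_image_of_injective _ hx.injective]

theorem transitionRow_image_admissible_iff {N m : ℕ} {x : Fin (m + 1) → Fin N}
    {y : Fin m → Fin N} (hx : StrictMono x) (hy : StrictMono y) :
    (HasUnitPartialSums (transitionRow (Finset.univ.image x) (Finset.univ.image y)) ∧
      ∑ j, (transitionRow (Finset.univ.image x) (Finset.univ.image y) j : ℤ) = 1) ↔
      ∀ i, y i ∈ Finset.Icc (x i.castSucc) (x i.succ) := by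
  rw [transitionRow_admissible_iff, ← interlacing_iff hx hy]
  simp [card_filter_image hx, card_filter_image hy, Finset.card_image_of_injective _ hx.injective,
    Finset.card_image_of_injective _ hy.injective]

theorem transferWeight_image {N m : ℕ} (l : ℕ) {x : Fin (m + 1) → Fin N} {y : Fin m → Fin N}
    (hx : StrictMono x) (hy : StrictMono y)
    (hxy : ∀ i, y i ∈ Finset.Icc (x i.castSucc) (x i.succ)) :
    transferWeight l (Finset.univ.image x) (Finset.univ.image y) =
      (∏ i, parityWeight (l + 1) (x i)) *
        ∏ i, endpointWeight (x i.castSucc) (x i.succ) (y i) * parityWeight l (y i) := by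
  unfold transferWeight
  rw [if_pos ((transitionRow_image_admissible_iff hx hy).2 hxy)]
  simp only [signWeight_transitionRow]
  rw [Finset.prod_mul_distrib, Finset.prod_ite_mem, Finset.prod_ite_mem, Finset.univ_inter,
    Finset.univ_inter, Finset.prod_image hx.injective.injOn, Finset.prod_image hy.injective.injOn]
  congr 1
  refine Finset.prod_congr rfl fun i _ => ?_
  congr 1
  unfold endpointWeight
  congr 1
  simp only [Finset.mem_image, Finset.mem_univ, true_and, eq_iff_iff]
  have hi := Finset.mem_Icc.1 (hxy i)
  constructor
  · rintro ⟨k, hk⟩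
    rw [← hk, hx.le_iff_le, hx.le_iff_le] at hi
    have : k = i.castSucc ∨ k = i.succ := by
      simp only [Fin.le_def, Fin.ext_iff, Fin.val_castSucc, Fin.val_succ] at hi ⊢
      omega
    rw [← hk]
    rcases this with rfl | rfl
    exacts [Or.inl rfl, Or.inr rfl]
  · rintro (h | h)
    exacts [⟨_, (Fin.ext h).symm⟩, ⟨_, (Fin.ext h).symm⟩]

open Classical in
theorem sum_transferWeight_mul {N m : ℕ} (l : ℕ) {x : Fin (m + 1) → Fin N} (hx : StrictMono x)
    (g : Finset (Fin N) → ℚ) :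
    ∑ Y, transferWeight l (Finset.univ.image x) Y * g Y =
      ∑ y ∈ Fintype.piFinset (fun i : Fin m => Finset.Icc (x i.castSucc) (x i.succ)) with
        StrictMono y, transferWeight l (Finset.univ.image x) (Finset.univ.image y) *
          g (Finset.univ.image y) := by
  symm
  apply Finset.sum_of_injOn (fun y : Fin m → Fin N => Finset.univ.image y)
  · intro y hy z hz hyz
    simp only [Finset.coe_filter, Set.mem_ofPred_eq] at hy hz
    rw [← StrictMono.range_inj hy.2 hz.2, ← Set.image_univ, ← Set.image_univ,
      ← Finset.coe_univ, ← Finset.coe_image, ← Finset.coe_image]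
    exact congrArg _ hyz
  · intro y _
    exact Finset.mem_coe.2 (Finset.mem_univ _)
  · intro Y _ hY
    unfold transferWeight
    rw [if_neg, zero_mul]
    intro h
    have hc := ((transitionRow_admissible_iff _ _).1 h).2
    rw [Finset.card_image_of_injective _ hx.injective, Finset.card_univ, Fintype.card_fin] at hc
    have hm : Y.card = m := by omega
    -- A set of nonzero weight has `m` elements, so its increasing enumeration is the required
    -- preimage.
    have hYi : Finset.univ.image (Y.orderEmbOfFin hm) = Y := by
      rw [← Finset.coe_inj, Finset.coe_image, Finset.coe_univ, Set.image_univ,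
        Finset.range_orderEmbOfFin]
    have hmono : StrictMono (Y.orderEmbOfFin hm) := (Y.orderEmbOfFin hm).strictMono
    apply hY
    refine ⟨Y.orderEmbOfFin hm, ?_, hYi⟩
    rw [Finset.mem_coe, Finset.mem_filter, Fintype.mem_piFinset]
    rw [← hYi] at h
    exact ⟨(transitionRow_image_admissible_iff hx hmono).1 h, hmono⟩
  · intro y _
    rfl

/-! ### Partial alternating sign matrices and the row recursion -/

theorem hasUnitPartialSums_snoc {m : ℕ} (a : Fin m → SignType) (s : SignType) :
    HasUnitPartialSums (Fin.snoc a s : Fin (m + 1) → SignType) ↔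
      HasUnitPartialSums a ∧ (∑ i, (a i : ℤ) + s = 0 ∨ ∑ i, (a i : ℤ) + s = 1) := by
  have h : ∀ k, signPartialSum (Fin.snoc a s : Fin (m + 1) → SignType) k =
      signPartialSum a k + if m < k then (s : ℤ) else 0 := by
    intro k
    simp [signPartialSum, Finset.sum_filter, Fin.sum_univ_castSucc]
  constructor
  · intro hs
    constructor
    · intro k
      by_cases hk : m < k
      · have := hs m
        rw [h, if_neg (lt_irrefl _), add_zero] at this
        rwa [signPartialSum_of_le a hk.le, ← signPartialSum_of_le a le_rfl]
      · have := hs k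
        rwa [h, if_neg hk, add_zero] at this
    · have := hs (m + 1)
      rwa [h, if_pos (by omega), signPartialSum_of_le a (by omega)] at this
  · rintro ⟨h1, h2⟩ k
    rw [h]
    by_cases hk : m < k
    · rwa [if_pos hk, signPartialSum_of_le a hk.le]
    · rw [if_neg hk, add_zero]
      exact h1 k

/-- Arrays of signs with unit row sums all of whose partial row and column sums are `0` or `1`. -/
def IsPartialASM {m N : ℕ} (A : Fin m → Fin N → SignType) : Prop :=
  (∀ i, HasUnitPartialSums (A i) ∧ ∑ j, (A i j : ℤ) = 1) ∧
    ∀ j, HasUnitPartialSums fun i => A i j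

open Classical in
/-- The weighted count of partial alternating sign matrices with `m` rows in which `X` is the set
of columns of sum `1`. -/
noncomputable def partialASMCount (m : ℕ) {N : ℕ} (X : Finset (Fin N)) : ℚ :=
  ∑ A : Fin m → Fin N → SignType with
    IsPartialASM A ∧ ∀ j, ∑ i, (A i j : ℤ) = if j ∈ X then 1 else 0,
    ∏ i : Fin m, ∏ j : Fin N, signWeight i j (A i j)

theorem partialASMCount_zero {N : ℕ} : partialASMCount 0 (∅ : Finset (Fin N)) = 1 := by
  classical
  unfold partialASMCount
  rw [Finset.filter_true_of_mem]
  · simp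
  · intro A _
    refine ⟨⟨fun i => i.elim0, fun j k => Or.inl ?_⟩, fun j => by simp⟩
    simp [signPartialSum]

theorem isPartialASM_snoc {m N : ℕ} (A : Fin m → Fin N → SignType) (r : Fin N → SignType)
    (X : Finset (Fin N)) :
    (IsPartialASM (Fin.snoc A r : Fin (m + 1) → Fin N → SignType) ∧
      ∀ j, ∑ i, ((Fin.snoc A r : Fin (m + 1) → Fin N → SignType) i j : ℤ) =
        if j ∈ X then 1 else 0) ↔
    IsPartialASM A ∧ (HasUnitPartialSums r ∧ ∑ j, (r j : ℤ) = 1) ∧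
      ∀ j, ∑ i, (A i j : ℤ) + r j = if j ∈ X then 1 else 0 := by
  have hcol : ∀ j, (fun i => (Fin.snoc A r : Fin (m + 1) → Fin N → SignType) i j) =
      (Fin.snoc (fun i => A i j) (r j) : Fin (m + 1) → SignType) := by
    intro j
    funext i
    induction i using Fin.lastCases <;> simp
  have hsum : ∀ j, ∑ i, ((Fin.snoc A r : Fin (m + 1) → Fin N → SignType) i j : ℤ) =
      ∑ i, (A i j : ℤ) + r j := by
    intro j
    simp [Fin.sum_univ_castSucc]
  unfold IsPartialASM
  simp only [hcol, hsum, hasUnitPartialSums_snoc, Fin.forall_fin_succ', Fin.snoc_castSucc,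
    Fin.snoc_last]
  constructor
  · rintro ⟨⟨⟨h1, h2⟩, h3⟩, h4⟩
    exact ⟨⟨h1, fun j => (h3 j).1⟩, h2, h4⟩
  · rintro ⟨⟨h1, h3⟩, h2, h4⟩
    refine ⟨⟨⟨h1, h2⟩, fun j => ⟨h3 j, ?_⟩⟩, h4⟩
    -- The column condition on the new row is automatic, as the prescribed column sums are `0` or
    -- `1`.
    rw [h4 j]
    split_ifs
    exacts [Or.inr rfl, Or.inl rfl]

theorem partialASMCount_succ (m : ℕ) {N : ℕ} (X : Finset (Fin N)) :
    partialASMCount (m + 1) X = ∑ Y, transferWeight m X Y * partialASMCount m Y := by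
  classical
  unfold partialASMCount
  rw [Finset.sum_filter,
    ← Equiv.sum_comp (M := ℚ) (Fin.snocEquiv fun _ : Fin (m + 1) => Fin N → SignType),
    Fintype.sum_prod_type_right]
  simp only [Finset.sum_filter, Finset.mul_sum]
  refine Eq.trans (Finset.sum_congr rfl fun A _ => ?_) Finset.sum_comm
  have e : ∀ r : Fin N → SignType,
      (Fin.snocEquiv fun _ : Fin (m + 1) => Fin N → SignType) (r, A) = Fin.snoc A r := fun r => rfl
  simp only [e, isPartialASM_snoc]
  by_cases hA : IsPartialASM A
  swap
  · simp [hA]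
  -- The array `A` of the upper rows determines `Y`, and then `X` and `Y` determine the last row, so
  -- both sums reduce to one term.
  set Y₀ : Finset (Fin N) := Finset.univ.filter fun j => ∑ i, (A i j : ℤ) = 1 with hY₀
  have hcols : ∀ j, ∑ i, (A i j : ℤ) = if j ∈ Y₀ then 1 else 0 := by
    intro j
    have := hA.2 j m
    rw [signPartialSum_of_le _ le_rfl] at this
    simp only [hY₀, Finset.mem_filter, Finset.mem_univ, true_and]
    split_ifs with h
    · exact h
    · exact this.resolve_right h
  rw [Finset.sum_eq_single Y₀]
  · simp only [hcols, implies_true, eq_transitionRow_iff, hA, true_and, and_true, if_true]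
    rw [Finset.sum_eq_single (transitionRow X Y₀)]
    · unfold transferWeight
      simp only [and_true]
      split_ifs with h
      · rw [Fin.prod_univ_castSucc, mul_comm]
        simp
      · simp
    · intro r _ hr
      simp [hr]
    · simp
  · intro Y _ hY
    rw [if_neg, mul_zero]
    rintro ⟨-, h⟩
    apply hY
    ext j
    have := (hcols j).symm.trans (h j)
    by_cases h1 : j ∈ Y <;> by_cases h2 : j ∈ Y₀ <;> simp_all
  · simp

/-- In the induction the parity weight at level `m` appears twice, once from the transfer weight and
once from the count for `y`; hence the square in `waveFunction`. -/
theorem partialASMCount_image {N m : ℕ} {x : Fin m → Fin N} (hx : StrictMono x) :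
    partialASMCount m (Finset.univ.image x) = (∏ i, parityWeight m (x i)) *
      (Matrix.of fun i j : Fin m => waveFunction j m (x i)).det := by
  classical
  induction m with
  | zero => simp [partialASMCount_zero]
  | succ m ih =>
    rw [partialASMCount_succ, sum_transferWeight_mul m hx]
    have hdet : (Matrix.of fun i j : Fin (m + 1) => waveFunction j (m + 1) (x i)) =
        Matrix.of fun i j : Fin (m + 1) =>
          (Fin.cons 1 (fun j : Fin m => trapezoidSum
            (fun y => parityWeight m y ^ 2 * waveFunction j m y) (x i)) : Fin (m + 1) → ℚ) j := by
      ext i j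
      induction j using Fin.cases <;> simp [waveFunction]
    rw [hdet, ← sum_interlacing_mul_det hx (fun y => parityWeight m y ^ 2)
      (fun j => waveFunction j m), Finset.mul_sum]
    refine Finset.sum_congr rfl fun y hy => ?_
    rw [Finset.mem_filter, Fintype.mem_piFinset] at hy
    rw [transferWeight_image m hx hy.2 hy.1, ih hy.2]
    simp only [Finset.prod_mul_distrib, Finset.prod_pow]
    ring

/-! ### The boundary condition and the evaluation -/

/-- The columns `2k + e` of an array of width `2n`. -/
def alternateColumn (n : ℕ) (e : Fin 2) (k : Fin n) : Fin (2 * n) :=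
  ⟨2 * k + e, by omega⟩

theorem alternateColumn_strictMono (n : ℕ) (e : Fin 2) : StrictMono (alternateColumn n e) := by
  intro i j hij
  simp only [alternateColumn, Fin.lt_def] at hij ⊢
  omega

theorem partialASMCount_alternateColumn (n : ℕ) (e : Fin 2) :
    partialASMCount n (Finset.univ.image (alternateColumn n e)) =
      (if Even (n + e) then 2 ^ n else 1) * 5 ^ n.choose 2 := by
  rw [partialASMCount_image (alternateColumn_strictMono n e), ← det_waveFunction n n e]
  congr 1
  · have : ∀ i, parityWeight n (alternateColumn n e i) = if Even (n + e) then 2 else 1 := by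
      intro i
      unfold parityWeight alternateColumn
      simp [Nat.even_add]
    simp only [this, Finset.prod_const, Finset.card_univ, Fintype.card_fin]
    split_ifs <;> simp
  · congr 1
    ext i j
    simp only [Matrix.of_apply, alternateColumn]
    congr 1
    ring

theorem prod_signWeight {n : ℕ} (A : Matrix (Fin n) (Fin (2 * n)) SignType) :
    ∏ i : Fin n, ∏ j : Fin (2 * n), signWeight i j (A i j) =
      2 ^ (numNegEven A + numPosOdd A) := by
  unfold numNegEven numPosOdd
  rw [← Finset.card_union_of_disjoint, ← Fintype.prod_prod_type', Finset.card_eq_sum_ones,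
    ← Finset.prod_pow_eq_pow_sum, ← Finset.filter_or, Finset.prod_filter]
  · refine Finset.prod_congr rfl fun p _ => ?_
    have hp : p.1.val + 1 + (p.2.val + 1) = p.1.val + p.2.val + 2 := by ring
    simp only [signWeight, hp, pow_one]
    have h2 : Even (p.1.val + p.2.val + 2) ↔ Even (p.1.val + p.2.val) := by
      rw [Nat.even_add]; simp
    simp only [← Nat.not_even_iff_odd, h2]
  · rw [Finset.disjoint_filter]
    rintro p _ ⟨h1, -⟩ ⟨h2, -⟩
    rw [h1] at h2
    exact absurd h2 (by decide)

theorem isHalvedASM_iff_isPartialASM {n : ℕ} (A : Matrix (Fin n) (Fin (2 * n)) SignType) :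
    IsHalvedASM A ↔ IsPartialASM A := by
  constructor
  · intro h
    refine ⟨fun i => ⟨?_, h.row_sum i⟩, fun j => ?_⟩
    · exact (hasUnitPartialSums_iff_of_sum_eq_one _ (h.row_sum i)).2 (h.row_alternating i)
    · exact (hasUnitPartialSums_iff _).2 ⟨h.col_alternating j, h.col_first j⟩
  · rintro ⟨h1, h2⟩
    exact ⟨fun i => ((hasUnitPartialSums_iff _).1 (h1 i).1).1,
      fun j => ((hasUnitPartialSums_iff _).1 (h2 j)).1, fun i => (h1 i).2,
      fun j => ((hasUnitPartialSums_iff _).1 (h2 j)).2⟩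

theorem heightMatrix_last {n : ℕ} (A : Matrix (Fin n) (Fin (2 * n)) SignType)
    (j : Fin (2 * n + 1)) :
    heightMatrix A (Fin.last n) j =
      n + j - 2 * ∑ r : Fin (2 * n) with r.val < j.val, ∑ l, (A l r : ℤ) := by
  unfold heightMatrix
  have h : (Finset.univ.filter fun l : Fin n => l.val + 1 ≤ (Fin.last n).val) = Finset.univ :=
    Finset.filter_true_of_mem fun l _ => l.2
  rw [h, Finset.sum_comm]
  rfl

theorem mem_image_alternateColumn {n : ℕ} (e : Fin 2) (j : Fin (2 * n)) :
    j ∈ Finset.univ.image (alternateColumn n e) ↔ j.val % 2 = e := by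
  simp only [Finset.mem_image, Finset.mem_univ, true_and, alternateColumn, Fin.ext_iff]
  constructor
  · rintro ⟨k, hk⟩
    omega
  · intro h
    exact ⟨⟨j / 2, by omega⟩, by simp only; omega⟩

/-- The bottom row says that the column sums accumulate to `S (2k) = k` and `S (2k + 1) = k + 1 -
e`. The top and left sides hold for every array, and the right side follows from the row sums. -/
theorem hasBoundary_iff {n : ℕ} {A : Matrix (Fin n) (Fin (2 * n)) SignType}
    (hrow : ∀ i, ∑ j, (A i j : ℤ) = 1) (e : Fin 2) :
    HasBoundary (heightMatrix A) (fun _ => (n : ℤ) - 1 + 2 * e) ↔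
      ∀ j, ∑ i, (A i j : ℤ) = if j ∈ Finset.univ.image (alternateColumn n e) then 1 else 0 := by
  simp only [mem_image_alternateColumn]
  set S : ℕ → ℤ := fun k => ∑ r : Fin (2 * n) with r.val < k, ∑ l, (A l r : ℤ) with hS
  have hlast : ∀ j : Fin (2 * n + 1), heightMatrix A (Fin.last n) j = n + j - 2 * S j :=
    heightMatrix_last A
  have hsucc : ∀ k : Fin (2 * n), S (k + 1) = S k + ∑ l, (A l k : ℤ) :=
    sum_filter_val_succ _
  constructor
  · intro h j
    have hev : ∀ k : Fin (n + 1), S (2 * k) = k := by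
      intro k
      have h1 := hlast ⟨2 * k, by omega⟩
      rw [h.bottom_even] at h1
      push_cast at h1
      omega
    have hodd : ∀ k : Fin n, S (2 * k + 1) = k + 1 - e := by
      intro k
      have h1 := hlast ⟨2 * k + 1, by omega⟩
      rw [h.bottom_odd] at h1
      push_cast at h1
      omega
    have hj := hsucc j
    have h1 := hodd ⟨j / 2, by omega⟩
    simp only at h1
    rcases Nat.mod_two_eq_zero_or_one j with hm | hm
    · have h2 := hev ⟨j / 2, by omega⟩
      simp only at h2
      have e1 : 2 * (j.val / 2) = j := by omega
      rw [e1] at h1 h2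
      split_ifs <;> omega
    · have h2 := hev ⟨j / 2 + 1, by omega⟩
      simp only at h2
      have e1 : 2 * (j.val / 2) + 1 = j := by omega
      have e2 : 2 * (j.val / 2 + 1) = j + 1 := by omega
      rw [e1] at h1
      rw [e2] at h2
      push_cast at h2
      split_ifs <;> omega
  · intro h
    have hval : ∀ k : ℕ, k ≤ n → S (2 * k) = k ∧ (k < n → S (2 * k + 1) = k + 1 - e) := by
      have hodd : ∀ k : ℕ, S (2 * k) = k → k < n → S (2 * k + 1) = k + 1 - e := by
        intro k h0 hk
        have h1 := hsucc ⟨2 * k, by omega⟩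
        rw [h] at h1
        simp only at h1
        rw [h1, h0]
        split_ifs <;> omega
      intro k
      induction k with
      | zero =>
        intro _
        have h0 : S (2 * 0) = (0 : ℕ) := by simp [hS]
        exact ⟨h0, hodd 0 h0⟩
      | succ k ih =>
        intro hk
        have h0 : S (2 * (k + 1)) = (k + 1 : ℕ) := by
          have h1 := hsucc ⟨2 * k + 1, by omega⟩
          rw [h] at h1
          simp only at h1
          rw [show 2 * (k + 1) = 2 * k + 1 + 1 by ring, h1, (ih (by omega)).2 (by omega)]
          push_cast
          split_ifs <;> omega
        exact ⟨h0, hodd _ h0⟩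
    refine ⟨fun j => ?_, fun i => ?_, fun i => ?_, fun k => ?_, fun k => ?_⟩
    · simp [heightMatrix]
    · simp [heightMatrix]
    · unfold heightMatrix
      have h1 : ∀ l, ∑ r : Fin (2 * n) with r.val + 1 ≤ (Fin.last (2 * n)).val, (A l r : ℤ) = 1 := by
        intro l
        rw [Finset.filter_true_of_mem (fun r _ => r.2), hrow]
      have h2 : (Finset.univ.filter fun l : Fin n => l.val + 1 ≤ i.val).card = i := by
        simp only [Nat.succ_le_iff, Fin.card_filter_val_lt]
        omega
      simp only [h1, Finset.sum_const, nsmul_one, h2]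
      rw [Fin.val_last]
      push_cast
      ring
    · rw [hlast]
      simp only [(hval k (by omega)).1]
      push_cast
      ring
    · rw [hlast]
      simp only [(hval k (by omega)).2 k.2]
      push_cast
      ring

theorem fortressCount_eq (n : ℕ) (e : Fin 2) :
    fortressCount n (fun _ => (n : ℤ) - 1 + 2 * e) =
      (if Even (n + e) then 2 ^ n else 1) * 5 ^ n.choose 2 := by
  have h : (fortressCount n (fun _ => (n : ℤ) - 1 + 2 * e) : ℚ) =
      partialASMCount n (Finset.univ.image (alternateColumn n e)) := by
    unfold fortressCount partialASMCount
    push_cast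
    rw [Finset.sum_filter, Finset.sum_filter]
    refine Finset.sum_congr rfl fun A _ => ?_
    have hA : (IsHalvedASM A ∧ HasBoundary (heightMatrix A) fun _ => (n : ℤ) - 1 + 2 * e) ↔
        IsPartialASM A ∧ ∀ j, ∑ i, (A i j : ℤ) =
          if j ∈ Finset.univ.image (alternateColumn n e) then 1 else 0 := by
      rw [isHalvedASM_iff_isPartialASM]
      exact and_congr_right fun hA => hasBoundary_iff (fun i => (hA.1 i).2) e
    by_cases h : IsHalvedASM A ∧ HasBoundary (heightMatrix A) fun _ => (n : ℤ) - 1 + 2 * e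
    · rw [if_pos h, if_pos (hA.1 h), prod_signWeight]
    · rw [if_neg h, if_neg (mt hA.2 h)]
  rw [partialASMCount_alternateColumn] at h
  exact_mod_cast h

theorem theorem3 (n : ℕ) :
    (Even n → fortressCount n (fun _ => (n : ℤ) + 1) = 5 ^ n.choose 2) ∧
    (Odd n → fortressCount n (fun _ => (n : ℤ) + 1) = 2 ^ n * 5 ^ n.choose 2) ∧
    (Even n → fortressCount n (fun _ => (n : ℤ) - 1) = 2 ^ n * 5 ^ n.choose 2) ∧
    (Odd n → fortressCount n (fun _ => (n : ℤ) - 1) = 5 ^ n.choose 2) := by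
  -- The bottom entries `n - 1` and `n + 1` correspond to `e = 0` and `e = 1`.
  have h0 := fortressCount_eq n 0
  have h1 := fortressCount_eq n 1
  have e1 : (n : ℤ) - 1 + 2 = n + 1 := by ring
  simp only [Fin.val_zero, Fin.val_one, Nat.cast_zero, Nat.cast_one, mul_zero, mul_one, add_zero,
    e1, Nat.even_add_one] at h0 h1
  rw [h0, h1]
  simp +contextual [← Nat.not_even_iff_odd]
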